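/- **Theorem.** Let $\mathbb{L}$ be a nonempty distributive lattice. Let $\mathbb{L}^*$ be the set of all lattice homomorphisms $x^*\colon\mathbb{L}\to[-1,1]$, and for $f\colon\mathbb{L}^*\to\mathbb{R}$ put $$\|f\| = \sup\Big\{\sum_{i=1}^n |f(x_i^*)| : n\in\mathbb{N},\ x_1^*,\dots,x_n^*\in\mathbb{L}^*,\ \sup_{x\in\mathbb{L}}\sum_{i=1}^n|x_i^*(x)|\le 1\Big\}.$$ Let $FBL\langle\mathbb{L}\rangle$ be the free Banach lattice generated by $\mathbb{L}$, that is, the smallest closed vector sublattice containing all evaluation functions $\delta_x\colon x^*\mapsto x^*(x)$ $(x\in\mathbb{L})$ inside the Banach lattice of all $f\colon\mathbb{L}^*\to\mathbb{R}$ with $\|f\|<\infty$, with the pointwise order and operations. A Banach lattice homomorphism is a bounded linear map that preserves the lattice operations. For a real number $\lambda>1$, a Banach lattice $P$ is called $\lambda$-projective if for every Banach lattice $X$, every closed ideal $J$ of $X$ with quotient map $Q\colon X\to X/J$, and every Banach lattice homomorphism $T\colon P\to X/J$, there is a Banach lattice homomorphism $\hat T\colon P\to X$ with $Q\circ\hat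 T=T$ and $\|\hat T\|\le\lambda\|T\|$. It is called $\infty$-projective if it is $\lambda$-projective for some real $\lambda>1$. If $FBL\langle\mathbb{L}\rangle$ is $\infty$-projective, then $\mathbb{L}$ has a maximum and a minimum. -/

import Mathlib

open scoped ENNReal

universe u

/-- `X` is a Banach lattice: a real Banach space that is a vector lattice and whose norm satisfies
`‖x‖ ≤ ‖y‖` whenever `|x| ≤ |y|`. -/
class IsBanachLattice (X : Type u) [NormedAddCommGroup X] [NormedSpace ℝ X] [Lattice X] : Prop
    extends IsOrderedAddMonoid X, PosSMulMono ℝ X, HasSolidNorm X, CompleteSpace X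

/-- Together with linearity and boundedness (which are bundled in `P →L[ℝ] X`), this says that
`T` is a Banach lattice homomorphism. -/
def PreservesLattice {P X : Type u} [Lattice P] [Lattice X] (T : P → X) : Prop :=
  (∀ a b, T (a ⊔ b) = T a ⊔ T b) ∧ ∀ a b, T (a ⊓ b) = T a ⊓ T b

/-! ### Closed ideals and the quotient Banach lattice -/

/-- A closed ideal of a Banach lattice: a norm-closed solid linear subspace. -/
structure ClosedIdeal (X : Type u) [NormedAddCommGroup X] [NormedSpace ℝ X] [Lattice X]
    extends Submodule ℝ X where
  solid : LatticeOrderedAddCommGroup.IsSolid (toSubmodule : Set X)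
  closed : IsClosed (toSubmodule : Set X)

namespace ClosedIdeal

section

variable {X : Type u} [NormedAddCommGroup X] [NormedSpace ℝ X] [Lattice X] (J : ClosedIdeal X)

instance instIsClosed : IsClosed (J.toSubmodule : Set X) := J.closed

variable [IsBanachLattice X]

theorem sup_sub_sup_mem {a b c d : X} (h : a - b ∈ J.toSubmodule) (h' : c - d ∈ J.toSubmodule) :
    a ⊔ c - b ⊔ d ∈ J.toSubmodule := by
  have h1 : a ⊔ c - b ⊔ c ∈ J.toSubmodule := J.solid h (abs_sup_sub_sup_le_abs a b c)
  have h2 : b ⊔ c - b ⊔ d ∈ J.toSubmodule := by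
    refine J.solid h' ?_
    rw [sup_comm b c, sup_comm b d]
    exact abs_sup_sub_sup_le_abs c d b
  simpa using J.toSubmodule.add_mem h1 h2

theorem inf_sub_inf_mem {a b c d : X} (h : a - b ∈ J.toSubmodule) (h' : c - d ∈ J.toSubmodule) :
    a ⊓ c - b ⊓ d ∈ J.toSubmodule := by
  have h1 : a ⊓ c - b ⊓ c ∈ J.toSubmodule := J.solid h (abs_inf_sub_inf_le_abs a b c)
  have h2 : b ⊓ c - b ⊓ d ∈ J.toSubmodule := by
    refine J.solid h' ?_
    rw [inf_comm b c, inf_comm b d]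
    exact abs_inf_sub_inf_le_abs c d b
  simpa using J.toSubmodule.add_mem h1 h2

instance instMaxQuotient : Max (X ⧸ J.toSubmodule) where
  max := Quotient.map₂ (fun a b : X => a ⊔ b) (fun _ _ h _ _ h' =>
    (Submodule.quotientRel_def _).2 (J.sup_sub_sup_mem
      ((Submodule.quotientRel_def _).1 h) ((Submodule.quotientRel_def _).1 h')))

instance instMinQuotient : Min (X ⧸ J.toSubmodule) where
  min := Quotient.map₂ (fun a b : X => a ⊓ b) (fun _ _ h _ _ h' =>
    (Submodule.quotientRel_def _).2 (J.inf_sub_inf_mem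
      ((Submodule.quotientRel_def _).1 h) ((Submodule.quotientRel_def _).1 h')))

theorem mk_sup (a b : X) : (Submodule.Quotient.mk (a ⊔ b) : X ⧸ J.toSubmodule) =
    Submodule.Quotient.mk a ⊔ Submodule.Quotient.mk b := rfl

theorem mk_inf (a b : X) : (Submodule.Quotient.mk (a ⊓ b) : X ⧸ J.toSubmodule) =
    Submodule.Quotient.mk a ⊓ Submodule.Quotient.mk b := rfl

/-- The quotient vector lattice `X ⧸ J`: the lattice operations are those of representatives.
Its norm is Mathlib's quotient norm. -/
instance instLatticeQuotient : Lattice (X ⧸ J.toSubmodule) :=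
  Lattice.mk'
    (by
      rintro ⟨a⟩ ⟨b⟩
      exact congrArg (Submodule.Quotient.mk (p := J.toSubmodule)) (sup_comm a b))
    (by
      rintro ⟨a⟩ ⟨b⟩ ⟨c⟩
      exact congrArg (Submodule.Quotient.mk (p := J.toSubmodule)) (sup_assoc a b c))
    (by
      rintro ⟨a⟩ ⟨b⟩
      exact congrArg (Submodule.Quotient.mk (p := J.toSubmodule)) (inf_comm a b))
    (by
      rintro ⟨a⟩ ⟨b⟩ ⟨c⟩
      exact congrArg (Submodule.Quotient.mk (p := J.toSubmodule)) (inf_assoc a b c))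
    (by
      rintro ⟨a⟩ ⟨b⟩
      exact congrArg (Submodule.Quotient.mk (p := J.toSubmodule)) (sup_inf_self (a := a) (b := b)))
    (by
      rintro ⟨a⟩ ⟨b⟩
      exact congrArg (Submodule.Quotient.mk (p := J.toSubmodule)) (inf_sup_self (a := a) (b := b)))

/-- The order of `X ⧸ J` is the usual quotient order. -/
theorem mk_le_mk_iff (a b : X) :
    (Submodule.Quotient.mk a : X ⧸ J.toSubmodule) ≤ Submodule.Quotient.mk b ↔
      ∃ j ∈ J.toSubmodule, a ≤ b + j := by
  rw [← sup_eq_right]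
  constructor
  · intro h
    have h' : (Submodule.Quotient.mk (a ⊔ b) : X ⧸ J.toSubmodule) = Submodule.Quotient.mk b := h
    rw [Submodule.Quotient.eq] at h'
    exact ⟨_, h', by rw [add_sub_cancel]; exact le_sup_left⟩
  · rintro ⟨j, hj, h⟩
    have h2 : (Submodule.Quotient.mk (a ⊔ b) : X ⧸ J.toSubmodule) = Submodule.Quotient.mk b := by
      rw [Submodule.Quotient.eq]
      refine J.solid hj ?_
      rw [abs_of_nonneg (sub_nonneg.2 le_sup_right), sub_le_iff_le_add]
      refine sup_le ?_ ?_
      · rw [add_comm]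
        exact h.trans (add_le_add_right (le_abs_self j) b)
      · exact le_add_of_nonneg_left (abs_nonneg j)
    exact h2

end

end ClosedIdeal

/-! ### Projectivity -/

/-- `P` is `lam`-projective: every Banach lattice homomorphism `T` from `P` to a quotient `X ⧸ J`
of a Banach lattice by a closed ideal lifts to a Banach lattice homomorphism `S : P → X` with
`‖S‖ ≤ lam * ‖T‖`. -/
def IsProjective (lam : ℝ) (P : Type u) [NormedAddCommGroup P] [NormedSpace ℝ P] [Lattice P] :
    Prop :=
  ∀ (X : Type u) [NormedAddCommGroup X] [NormedSpace ℝ X] [Lattice X] [IsBanachLattice X]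
    (J : ClosedIdeal X) (T : P →L[ℝ] X ⧸ J.toSubmodule), PreservesLattice T →
    ∃ S : P →L[ℝ] X, PreservesLattice S ∧
      (∀ p, (Submodule.Quotient.mk (S p) : X ⧸ J.toSubmodule) = T p) ∧ ‖S‖ ≤ lam * ‖T‖

/-- `P` is `∞`-projective: it is `lam`-projective for some real `lam > 1`. -/
def IsInftyProjective (P : Type u) [NormedAddCommGroup P] [NormedSpace ℝ P] [Lattice P] : Prop :=
  ∃ lam : ℝ, 1 < lam ∧ IsProjective lam P

/-! ### Closed vector sublattices -/

/-- A closed vector sublattice of a Banach lattice. -/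
structure ClosedVectorSublattice (X : Type u) [NormedAddCommGroup X] [NormedSpace ℝ X] [Lattice X]
    extends Submodule ℝ X where
  sup_mem : ∀ ⦃a b : X⦄, a ∈ toSubmodule → b ∈ toSubmodule → a ⊔ b ∈ toSubmodule
  inf_mem : ∀ ⦃a b : X⦄, a ∈ toSubmodule → b ∈ toSubmodule → a ⊓ b ∈ toSubmodule
  closed : IsClosed (toSubmodule : Set X)

namespace ClosedVectorSublattice

section

variable {X : Type u} [NormedAddCommGroup X] [NormedSpace ℝ X] [Lattice X]

instance instLattice (S : ClosedVectorSublattice X) : Lattice S.toSubmodule :=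
  Subtype.lattice (fun _ _ ha hb => S.sup_mem ha hb) (fun _ _ ha hb => S.inf_mem ha hb)

instance instIsBanachLattice [IsBanachLattice X] (S : ClosedVectorSublattice X) :
    IsBanachLattice S.toSubmodule where
  add_le_add_left _ _ h c := add_le_add_left (α := X) h c
  smul_le_smul_of_nonneg_left _ hr _ _ h := smul_le_smul_of_nonneg_left (β := X) h hr
  solid _ _ h := HasSolidNorm.solid (α := X) h
  complete := (completeSpace_coe_iff_isComplete.2 S.closed.isComplete).complete

/-- The closed vector sublattice (i.e. the Banach lattice) generated by a set: the smallest closed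
vector sublattice containing it. -/
def generate (A : Set X) : ClosedVectorSublattice X where
  toSubmodule := sInf {V | ∃ S : ClosedVectorSublattice X, S.toSubmodule = V ∧ A ⊆ V}
  sup_mem a b ha hb := by
    rw [Submodule.mem_sInf] at *
    rintro V ⟨S, rfl, hS⟩
    exact S.sup_mem (ha _ ⟨S, rfl, hS⟩) (hb _ ⟨S, rfl, hS⟩)
  inf_mem a b ha hb := by
    rw [Submodule.mem_sInf] at *
    rintro V ⟨S, rfl, hS⟩
    exact S.inf_mem (ha _ ⟨S, rfl, hS⟩) (hb _ ⟨S, rfl, hS⟩)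
  closed := by
    rw [Submodule.coe_sInf]
    refine isClosed_biInter ?_
    rintro V ⟨S, rfl, -⟩
    exact S.closed

end

end ClosedVectorSublattice

/-! ### The free Banach lattice generated by a lattice -/

/-- `𝕃*`: the lattice homomorphisms from `L` to `[-1, 1]`. -/
abbrev LatticeDual (L : Type u) [Lattice L] : Type u := LatticeHom L (Set.Icc (-1 : ℝ) 1)

namespace FreeBanachLattice

section

variable {L : Type u} [Lattice L]

/-- The finite families `x₁, …, xₙ` in `𝕃*` with `∑ |xᵢ(a)| ≤ 1` for all `a` in `L`. -/
def Admissible {n : ℕ} (x : Fin n → LatticeDual L) : Prop :=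
  ∀ a : L, ∑ i, |(x i a : ℝ)| ≤ 1

/-- The (possibly infinite) norm
`‖f‖ = sup {∑ |f(xᵢ)| : (xᵢ) a finite family in 𝕃* with sup_a ∑ |xᵢ(a)| ≤ 1}`. -/
noncomputable def extNorm (f : LatticeDual L → ℝ) : ℝ≥0∞ :=
  ⨆ (n : ℕ) (x : Fin n → LatticeDual L) (_ : Admissible x), ENNReal.ofReal (∑ i, |f (x i)|)

theorem le_extNorm (f : LatticeDual L → ℝ) {n : ℕ} {x : Fin n → LatticeDual L}
    (hx : Admissible x) : ENNReal.ofReal (∑ i, |f (x i)|) ≤ extNorm f :=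
  le_iSup_of_le n (le_iSup_of_le x (le_iSup_of_le hx le_rfl))

theorem extNorm_le {f : LatticeDual L → ℝ} {c : ℝ≥0∞}
    (h : ∀ (n : ℕ) (x : Fin n → LatticeDual L), Admissible x →
      ENNReal.ofReal (∑ i, |f (x i)|) ≤ c) : extNorm f ≤ c :=
  iSup_le fun n => iSup_le fun x => iSup_le fun hx => h n x hx

theorem extNorm_mono {f g : LatticeDual L → ℝ} (h : ∀ x, |f x| ≤ |g x|) :
    extNorm f ≤ extNorm g :=
  extNorm_le fun _ _ hx =>
    (ENNReal.ofReal_le_ofReal (Finset.sum_le_sum fun _ _ => h _)).trans (le_extNorm g hx)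

theorem extNorm_zero : extNorm (0 : LatticeDual L → ℝ) = 0 :=
  le_antisymm (extNorm_le fun n x _ => by simp) zero_le

theorem extNorm_add_le (f g : LatticeDual L → ℝ) :
    extNorm (f + g) ≤ extNorm f + extNorm g := by
  refine extNorm_le fun n x hx => ?_
  refine le_trans ?_ (add_le_add (le_extNorm f hx) (le_extNorm g hx))
  rw [← ENNReal.ofReal_add (Finset.sum_nonneg fun _ _ => abs_nonneg _)
    (Finset.sum_nonneg fun _ _ => abs_nonneg _), ← Finset.sum_add_distrib]
  exact ENNReal.ofReal_le_ofReal (Finset.sum_le_sum fun _ _ => abs_add_le _ _)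

theorem extNorm_smul_le (c : ℝ) (f : LatticeDual L → ℝ) :
    extNorm (c • f) ≤ ENNReal.ofReal |c| * extNorm f := by
  refine extNorm_le fun n x hx => ?_
  refine le_trans (le_of_eq ?_) (mul_le_mul_right (le_extNorm f hx) _)
  rw [← ENNReal.ofReal_mul (abs_nonneg c), Finset.mul_sum]
  simp [abs_mul]

theorem admissible_single (y : LatticeDual L) : Admissible (fun _ : Fin 1 => y) := by
  intro a
  simpa using abs_le.2 (y a).2

theorem ofReal_abs_le_extNorm (f : LatticeDual L → ℝ) (y : LatticeDual L) :
    ENNReal.ofReal |f y| ≤ extNorm f := by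
  simpa using le_extNorm f (admissible_single y)

variable (L) in
/-- The functions on `𝕃*` of finite norm, as a linear subspace. -/
noncomputable def finiteNorm : Submodule ℝ (LatticeDual L → ℝ) where
  carrier := {f | extNorm f < ∞}
  zero_mem' := by simp [extNorm_zero]
  add_mem' hf hg := (extNorm_add_le _ _).trans_lt (ENNReal.add_lt_top.2 ⟨hf, hg⟩)
  smul_mem' c f hf := (extNorm_smul_le c f).trans_lt (ENNReal.mul_lt_top ENNReal.ofReal_lt_top hf)

variable (L) in
/-- The Banach lattice of all functions `f : 𝕃* → ℝ` with `‖f‖ < ∞`, with pointwise order and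
operations. -/
def FunSpace : Type u := finiteNorm L

namespace FunSpace

noncomputable instance instAddCommGroup : AddCommGroup (FunSpace L) :=
  inferInstanceAs (AddCommGroup (finiteNorm L))

noncomputable instance instModule : Module ℝ (FunSpace L) :=
  inferInstanceAs (Module ℝ (finiteNorm L))

instance instFunLike : FunLike (FunSpace L) (LatticeDual L) ℝ where
  coe f := f.1
  coe_injective _ _ h := Subtype.ext h

/-- A function of finite norm, as an element of `FunSpace L`. -/
def ofFun (f : LatticeDual L → ℝ) (hf : extNorm f < ∞) : FunSpace L := ⟨f, hf⟩

theorem ofFun_apply (f : LatticeDual L → ℝ) (hf : extNorm f < ∞) (x : LatticeDual L) :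
    ofFun f hf x = f x := rfl

theorem extNorm_lt_top (f : FunSpace L) : extNorm f < ∞ := f.2

theorem coe_add (f g : FunSpace L) : ⇑(f + g) = f + g := rfl

theorem coe_sub (f g : FunSpace L) : ⇑(f - g) = f - g := rfl

theorem coe_smul (c : ℝ) (f : FunSpace L) : ⇑(c • f) = c • ⇑f := rfl

noncomputable instance instLattice : Lattice (FunSpace L) :=
  Subtype.lattice
    (P := fun f : LatticeDual L → ℝ => f ∈ finiteNorm L)
    (fun f g hf hg => by
      have h : extNorm (|f| + |g|) < ∞ :=
        (extNorm_add_le _ _).trans_lt (ENNReal.add_lt_top.2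
          ⟨(extNorm_mono fun x => by simp).trans_lt hf,
            (extNorm_mono fun x => by simp).trans_lt hg⟩)
      refine (extNorm_mono fun x => ?_).trans_lt h
      have h1 := abs_nonneg (f x)
      have h2 := abs_nonneg (g x)
      simp only [Pi.sup_apply, Pi.add_apply, Pi.abs_apply]
      rw [abs_of_nonneg (add_nonneg h1 h2)]
      exact abs_max_le_max_abs_abs.trans (max_le (by linarith) (by linarith)))
    (fun f g hf hg => by
      have h : extNorm (|f| + |g|) < ∞ :=
        (extNorm_add_le _ _).trans_lt (ENNReal.add_lt_top.2
          ⟨(extNorm_mono fun x => by simp).trans_lt hf,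
            (extNorm_mono fun x => by simp).trans_lt hg⟩)
      refine (extNorm_mono fun x => ?_).trans_lt h
      have h1 := abs_nonneg (f x)
      have h2 := abs_nonneg (g x)
      simp only [Pi.inf_apply, Pi.add_apply, Pi.abs_apply]
      rw [abs_of_nonneg (add_nonneg h1 h2)]
      exact abs_min_le_max_abs_abs.trans (max_le (by linarith) (by linarith)))

theorem coe_sup (f g : FunSpace L) : ⇑(f ⊔ g) = ⇑f ⊔ ⇑g := rfl

theorem coe_inf (f g : FunSpace L) : ⇑(f ⊓ g) = ⇑f ⊓ ⇑g := rfl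

theorem abs_apply (f : FunSpace L) (x : LatticeDual L) : |f| x = |f x| := rfl

noncomputable instance instNorm : Norm (FunSpace L) where
  norm f := (extNorm f).toReal

theorem norm_def (f : FunSpace L) : ‖f‖ = (extNorm f).toReal := rfl

theorem sum_le_norm (f : FunSpace L) {n : ℕ} {x : Fin n → LatticeDual L} (hx : Admissible x) :
    ∑ i, |f (x i)| ≤ ‖f‖ :=
  (ENNReal.ofReal_le_iff_le_toReal f.extNorm_lt_top.ne).1 (le_extNorm f hx)

theorem norm_le {f : FunSpace L} {c : ℝ} (hc : 0 ≤ c)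
    (h : ∀ (n : ℕ) (x : Fin n → LatticeDual L), Admissible x → ∑ i, |f (x i)| ≤ c) : ‖f‖ ≤ c :=
  ENNReal.toReal_le_of_le_ofReal hc (extNorm_le fun n x hx => ENNReal.ofReal_le_ofReal (h n x hx))

theorem abs_apply_le_norm (f : FunSpace L) (y : LatticeDual L) : |f y| ≤ ‖f‖ := by
  simpa using sum_le_norm f (admissible_single y)

theorem norm_nonneg' (f : FunSpace L) : 0 ≤ ‖f‖ := ENNReal.toReal_nonneg

theorem normCore : NormedSpace.Core ℝ (FunSpace L) where
  norm_nonneg := norm_nonneg'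
  norm_smul := by
    have key : ∀ (c : ℝ) (f : FunSpace L), ‖c • f‖ ≤ ‖c‖ * ‖f‖ := by
      intro c f
      refine norm_le (mul_nonneg (norm_nonneg c) (norm_nonneg' f)) fun n x hx => ?_
      have h1 : ∑ i, |(c • f) (x i)| = |c| * ∑ i, |f (x i)| := by
        rw [Finset.mul_sum]
        simp [coe_smul, abs_mul]
      rw [h1]
      exact mul_le_mul_of_nonneg_left (sum_le_norm f hx) (abs_nonneg c)
    intro c f
    refine le_antisymm (key c f) ?_
    rcases eq_or_ne c 0 with rfl | hc
    · simpa using norm_nonneg' _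
    · have h := key c⁻¹ (c • f)
      rw [inv_smul_smul₀ hc, norm_inv, inv_mul_eq_div, le_div_iff₀ (norm_pos_iff.2 hc)] at h
      linarith
  norm_triangle f g := by
    refine norm_le (add_nonneg (norm_nonneg' f) (norm_nonneg' g)) fun n x hx => ?_
    refine le_trans ?_ (add_le_add (sum_le_norm f hx) (sum_le_norm g hx))
    rw [← Finset.sum_add_distrib]
    exact Finset.sum_le_sum fun _ _ => abs_add_le _ _
  norm_eq_zero_iff f := by
    constructor
    · intro h
      refine DFunLike.ext _ _ fun y => ?_
      have := abs_apply_le_norm f y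
      rw [h] at this
      exact abs_eq_zero.1 (le_antisymm this (abs_nonneg _))
    · rintro rfl
      exact le_antisymm (norm_le le_rfl fun n x _ =>
        (Finset.sum_eq_zero fun i _ => abs_eq_zero.2 rfl).le) (norm_nonneg' _)

noncomputable instance instNormedAddCommGroup : NormedAddCommGroup (FunSpace L) :=
  NormedAddCommGroup.ofCore normCore

noncomputable instance instNormedSpace : NormedSpace ℝ (FunSpace L) :=
  NormedSpace.ofCore normCore

theorem complete : CompleteSpace (FunSpace L) := by
  refine Metric.complete_of_cauchySeq_tendsto fun u hu => ?_
  have hpt : ∀ y, ∃ l, Filter.Tendsto (fun n => u n y) Filter.atTop (nhds l) := by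
    intro y
    refine cauchySeq_tendsto_of_complete ?_
    rw [Metric.cauchySeq_iff] at hu ⊢
    intro ε hε
    obtain ⟨N, hN⟩ := hu ε hε
    refine ⟨N, fun m hm n hn => ?_⟩
    rw [Real.dist_eq]
    have h := hN m hm n hn
    rw [dist_eq_norm] at h
    exact (abs_apply_le_norm (u m - u n) y).trans_lt h
  choose g hg using hpt
  have key : ∀ ε > 0, ∃ N, ∀ m ≥ N, ∀ (k : ℕ) (x : Fin k → LatticeDual L), Admissible x →
      ∑ i, |u m (x i) - g (x i)| ≤ ε := by
    intro ε hε
    obtain ⟨N, hN⟩ := Metric.cauchySeq_iff.1 hu ε hε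
    refine ⟨N, fun m hm k x hx => ?_⟩
    have ht : Filter.Tendsto (fun n => ∑ i, |u m (x i) - u n (x i)|) Filter.atTop
        (nhds (∑ i, |u m (x i) - g (x i)|)) :=
      tendsto_finsetSum _ fun i _ => (tendsto_const_nhds.sub (hg (x i))).abs
    refine le_of_tendsto ht (Filter.eventually_atTop.2 ⟨N, fun n hn => ?_⟩)
    have h := hN m hm n hn
    rw [dist_eq_norm] at h
    exact (sum_le_norm (u m - u n) hx).trans h.le
  have hmem : g ∈ finiteNorm L := by
    obtain ⟨N, hN⟩ := key 1 one_pos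
    have h1 : u N - g ∈ finiteNorm L := by
      refine (extNorm_le (c := ENNReal.ofReal 1) fun k x hx => ?_).trans_lt ENNReal.ofReal_lt_top
      exact ENNReal.ofReal_le_ofReal (hN N le_rfl k x hx)
    have h2 := (finiteNorm L).sub_mem (u N).2 h1
    have h3 : (u N).1 - (⇑(u N) - g) = g := sub_sub_cancel _ _
    rwa [h3] at h2
  refine ⟨ofFun g hmem, ?_⟩
  rw [Metric.tendsto_atTop]
  intro ε hε
  obtain ⟨N, hN⟩ := key (ε / 2) (half_pos hε)
  refine ⟨N, fun m hm => ?_⟩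
  rw [dist_eq_norm]
  refine lt_of_le_of_lt (norm_le (half_pos hε).le fun k x hx => ?_) (half_lt_self hε)
  exact hN m hm k x hx

instance instIsBanachLattice : IsBanachLattice (FunSpace L) where
  add_le_add_left _ _ h c := fun x => add_le_add_left (h x) (c x)
  smul_le_smul_of_nonneg_left _ hr _ _ h := fun x => mul_le_mul_of_nonneg_left (h x) hr
  solid f g h := by
    refine norm_le (norm_nonneg g) fun n x hx => ?_
    exact (Finset.sum_le_sum fun i _ => h (x i)).trans (sum_le_norm g hx)
  complete := complete.complete

end FunSpace

/-- The evaluation function `δ_a : 𝕃* → ℝ`, `δ_a(x) = x(a)`. -/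
noncomputable def delta (a : L) : FunSpace L :=
  FunSpace.ofFun (fun x => (x a : ℝ))
    ((extNorm_le fun _ _ hx => ENNReal.ofReal_le_ofReal (hx a)).trans_lt ENNReal.ofReal_lt_top)

end

end FreeBanachLattice

/-- `FBL⟨L⟩`, the free Banach lattice generated by the lattice `L`: the Banach lattice generated by
the evaluation functions inside the Banach lattice of functions on `𝕃*` of finite norm. -/
abbrev FBL (L : Type u) [Lattice L] : Type u :=
  (ClosedVectorSublattice.generate (Set.range (FreeBanachLattice.delta (L := L)))).toSubmodule

/-! ### Functions whose absolute values have bounded sums along chains of a relation -/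

/-! Suppose `L` has no maximum. By the prime ideal theorem for distributive lattices, every finite
`G ⊆ L` admits an `x` in `𝕃*` that vanishes on `G` and takes the value `1` somewhere. A quotient is
built in which the evaluations have a bounded image, while every increasing lift of them is
unbounded.

The space consists of functions of pairs `(x, F)`, with `x ∈ 𝕃*` and `F ⊆ L` finite, normed by sums
along chains in which the sets grow and each homomorphism vanishes on all earlier sets. The ideal
consists of the functions tending to `0` as `F` grows with `x` fixed, so that a class remembers a
limit at each `x`. Every `p` in `FBL L` is uniformly small on the homomorphisms vanishing on a large
`F` (`mem_tailSmall_of_FBL`). Hence soft thresholding `p x` by the supremum of `|p|` over those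
homomorphisms leaves the limit `p x` unchanged (`tendsto_trunc`), and it makes the chain sums
telescope to at most `‖p‖` (`sum_abs_truncFun_le`). This gives a Banach lattice homomorphism into
the quotient.

A lift sends the evaluations to a bounded increasing family `g a` with limits `x a`. Choosing `x` as
above again and again gives chains of any length `N` whose pairs each carry a value at least `1/2`
of some `g d`. By monotonicity a single `g b` is at least `1/2` on the whole chain, so its norm is
at least `N/2` (`exists_long_chain`, `false_of_bounded_of_step`). The minimum is handled by
reversing the order and the sign. -/

/-- The functions `f` on `Ω` for which the sums `∑ |f w|` over the finite chains of the relation `R`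
are bounded, as a linear subspace. -/
def chainSubmodule {Ω : Type u} (R : Ω → Ω → Prop) : Submodule ℝ (Ω → ℝ) where
  carrier := {f | ∃ C, ∀ l : List Ω, l.Pairwise R → (l.map fun w => |f w|).sum ≤ C}
  zero_mem' := ⟨0, fun l _ => by simp⟩
  add_mem' := by
    rintro f g ⟨C, hC⟩ ⟨D, hD⟩
    refine ⟨C + D, fun l hl => ?_⟩
    refine le_trans ?_ (add_le_add (hC l hl) (hD l hl))
    rw [← List.sum_map_add]
    exact List.sum_le_sum fun _ _ => abs_add_le _ _
  smul_mem' := by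
    rintro c f ⟨C, hC⟩
    refine ⟨|c| * C, fun l hl => ?_⟩
    refine le_trans (le_of_eq ?_) (mul_le_mul_of_nonneg_left (hC l hl) (abs_nonneg c))
    rw [← List.sum_map_mul_left]
    simp [abs_mul]

/-- The Banach lattice of functions on `Ω` with bounded absolute sums along the finite chains of
`R`, with pointwise order and operations. -/
def ChainSpace {Ω : Type u} (R : Ω → Ω → Prop) : Type u := chainSubmodule R

namespace ChainSpace

section

variable {Ω : Type u} {R : Ω → Ω → Prop}

noncomputable instance instAddCommGroup : AddCommGroup (ChainSpace R) :=
  inferInstanceAs (AddCommGroup (chainSubmodule R))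

noncomputable instance instModule : Module ℝ (ChainSpace R) :=
  inferInstanceAs (Module ℝ (chainSubmodule R))

instance instFunLike : FunLike (ChainSpace R) Ω ℝ where
  coe f := f.1
  coe_injective _ _ h := Subtype.ext h

/-- A function with bounded absolute sums along chains, as an element of `ChainSpace R`. -/
def ofFun (f : Ω → ℝ) (hf : f ∈ chainSubmodule R) : ChainSpace R := ⟨f, hf⟩

@[simp] theorem ofFun_apply (f : Ω → ℝ) (hf : f ∈ chainSubmodule R) (w : Ω) :
    ofFun f hf w = f w := rfl

@[simp] theorem zero_apply (w : Ω) : (0 : ChainSpace R) w = 0 := rfl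

@[simp] theorem add_apply (f g : ChainSpace R) (w : Ω) : (f + g) w = f w + g w := rfl

@[simp] theorem sub_apply (f g : ChainSpace R) (w : Ω) : (f - g) w = f w - g w := rfl

@[simp] theorem smul_apply (c : ℝ) (f : ChainSpace R) (w : Ω) : (c • f) w = c * f w := rfl

/-- Both `|f ⊔ g|` and `|f ⊓ g|` are pointwise at most `|f| + |g|`, so this yields closure under
both lattice operations. -/
theorem mem_of_abs_le_add {f g h : Ω → ℝ} (hf : f ∈ chainSubmodule R)
    (hg : g ∈ chainSubmodule R) (hh : ∀ w, |h w| ≤ |f w| + |g w|) : h ∈ chainSubmodule R := by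
  obtain ⟨C, hC⟩ := hf
  obtain ⟨D, hD⟩ := hg
  refine ⟨C + D, fun l hl => ?_⟩
  refine le_trans ?_ (add_le_add (hC l hl) (hD l hl))
  rw [← List.sum_map_add]
  exact List.sum_le_sum fun w _ => hh w

noncomputable instance instLattice : Lattice (ChainSpace R) :=
  Subtype.lattice (P := fun f : Ω → ℝ => f ∈ chainSubmodule R)
    (fun _ _ hf hg => mem_of_abs_le_add hf hg fun _ => abs_max_le_max_abs_abs.trans
      (max_le_add_of_nonneg (abs_nonneg _) (abs_nonneg _)))
    (fun _ _ hf hg => mem_of_abs_le_add hf hg fun _ => abs_min_le_max_abs_abs.trans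
      (max_le_add_of_nonneg (abs_nonneg _) (abs_nonneg _)))

noncomputable instance instNorm : Norm (ChainSpace R) where
  norm f := ⨆ l : {l : List Ω // l.Pairwise R}, (l.1.map fun w => |f w|).sum

theorem sum_le_norm (f : ChainSpace R) {l : List Ω} (hl : l.Pairwise R) :
    (l.map fun w => |f w|).sum ≤ ‖f‖ := by
  obtain ⟨C, hC⟩ := f.2
  exact le_ciSup (f := fun l : {l : List Ω // l.Pairwise R} => (l.1.map fun w => |f w|).sum)
    ⟨C, by rintro _ ⟨l, rfl⟩; exact hC l.1 l.2⟩ ⟨l, hl⟩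

theorem norm_le {f : ChainSpace R} {c : ℝ}
    (h : ∀ l : List Ω, l.Pairwise R → (l.map fun w => |f w|).sum ≤ c) : ‖f‖ ≤ c :=
  haveI : Nonempty {l : List Ω // l.Pairwise R} := ⟨⟨[], List.Pairwise.nil⟩⟩
  ciSup_le fun l => h l.1 l.2

theorem abs_apply_le_norm (f : ChainSpace R) (w : Ω) : |f w| ≤ ‖f‖ := by
  simpa using sum_le_norm f (List.pairwise_singleton R w)

theorem norm_nonneg' (f : ChainSpace R) : 0 ≤ ‖f‖ := by
  simpa using sum_le_norm f (List.Pairwise.nil (R := R))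

theorem normCore : NormedSpace.Core ℝ (ChainSpace R) where
  norm_nonneg := norm_nonneg'
  norm_smul := by
    have key : ∀ (c : ℝ) (f : ChainSpace R), ‖c • f‖ ≤ ‖c‖ * ‖f‖ := by
      intro c f
      refine norm_le fun l hl => ?_
      have h1 : (l.map fun w => |(c • f) w|).sum = |c| * (l.map fun w => |f w|).sum := by
        rw [← List.sum_map_mul_left]
        simp [abs_mul]
      rw [h1]
      exact mul_le_mul_of_nonneg_left (sum_le_norm f hl) (abs_nonneg c)
    intro c f
    refine le_antisymm (key c f) ?_
    rcases eq_or_ne c 0 with rfl | hc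
    · simpa using norm_nonneg' _
    · have h := key c⁻¹ (c • f)
      rw [inv_smul_smul₀ hc, norm_inv, inv_mul_eq_div, le_div_iff₀ (norm_pos_iff.2 hc)] at h
      linarith
  norm_triangle f g := by
    refine norm_le fun l hl => ?_
    refine le_trans ?_ (add_le_add (sum_le_norm f hl) (sum_le_norm g hl))
    rw [← List.sum_map_add]
    exact List.sum_le_sum fun _ _ => abs_add_le _ _
  norm_eq_zero_iff f := by
    constructor
    · intro h
      refine DFunLike.ext _ _ fun w => ?_
      have := abs_apply_le_norm f w
      rw [h] at this
      exact abs_eq_zero.1 (le_antisymm this (abs_nonneg _))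
    · rintro rfl
      exact le_antisymm (norm_le fun l _ => by simp) (norm_nonneg' _)

noncomputable instance instNormedAddCommGroup : NormedAddCommGroup (ChainSpace R) :=
  NormedAddCommGroup.ofCore normCore

noncomputable instance instNormedSpace : NormedSpace ℝ (ChainSpace R) :=
  NormedSpace.ofCore normCore

/-- The norm dominates point values, so a Cauchy sequence converges pointwise. The Cauchy estimate
on a fixed finite chain passes to the limit with an index that does not depend on the chain. -/
theorem complete : CompleteSpace (ChainSpace R) := by
  refine Metric.complete_of_cauchySeq_tendsto fun u hu => ?_
  rw [Metric.cauchySeq_iff] at hu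
  have hpt : ∀ w, ∃ a, Filter.Tendsto (fun n => u n w) Filter.atTop (nhds a) := by
    intro w
    refine cauchySeq_tendsto_of_complete (Metric.cauchySeq_iff.2 fun ε hε => ?_)
    obtain ⟨N, hN⟩ := hu ε hε
    refine ⟨N, fun m hm n hn => ?_⟩
    have h := hN m hm n hn
    rw [dist_eq_norm] at h
    exact (abs_apply_le_norm (u m - u n) w).trans_lt h
  choose g hg using hpt
  have key : ∀ ε > 0, ∃ N, ∀ m ≥ N, ∀ l : List Ω, l.Pairwise R →
      (l.map fun w => |u m w - g w|).sum ≤ ε := by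
    intro ε hε
    obtain ⟨N, hN⟩ := hu ε hε
    refine ⟨N, fun m hm l hl => ?_⟩
    have ht : Filter.Tendsto (fun n => (l.map fun w => |u m w - u n w|).sum) Filter.atTop
        (nhds (l.map fun w => |u m w - g w|).sum) :=
      tendsto_list_sum l fun w _ => (tendsto_const_nhds.sub (hg w)).abs
    refine le_of_tendsto ht (Filter.eventually_atTop.2 ⟨N, fun n hn => ?_⟩)
    have h := hN m hm n hn
    rw [dist_eq_norm] at h
    exact (sum_le_norm (u m - u n) hl).trans h.le
  have hmem : g ∈ chainSubmodule R := by
    obtain ⟨N, hN⟩ := key 1 one_pos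
    have h1 : (u N).1 - g ∈ chainSubmodule R := ⟨1, hN N le_rfl⟩
    have h2 := (chainSubmodule R).sub_mem (u N).2 h1
    rwa [sub_sub_cancel] at h2
  refine ⟨ofFun g hmem, Metric.tendsto_atTop.2 fun ε hε => ?_⟩
  obtain ⟨N, hN⟩ := key (ε / 2) (half_pos hε)
  refine ⟨N, fun m hm => ?_⟩
  rw [dist_eq_norm]
  exact (norm_le fun l hl => hN m hm l hl).trans_lt (half_lt_self hε)

instance instIsBanachLattice : IsBanachLattice (ChainSpace R) where
  add_le_add_left _ _ h c := fun w => add_le_add_left (h w) (c w)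
  smul_le_smul_of_nonneg_left _ hr _ _ h := fun w => mul_le_mul_of_nonneg_left (h w) hr
  solid _ g h :=
    norm_le fun _ hl => (List.sum_le_sum fun w _ => h w).trans (sum_le_norm g hl)
  complete := complete.complete

/-- The functions that tend to `0` along each member of a family of filters form a closed ideal. -/
def tendstoZeroIdeal (R : Ω → Ω → Prop) {ι : Type*} (φ : ι → Filter Ω) :
    ClosedIdeal (ChainSpace R) where
  carrier := {f | ∀ i, Filter.Tendsto f (φ i) (nhds 0)}
  zero_mem' _ := tendsto_const_nhds
  add_mem' hf hg i := (add_zero (0 : ℝ)) ▸ (hf i).add (hg i)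
  smul_mem' c f hf i := (mul_zero c) ▸ (hf i).const_mul c
  solid f hf g h i := squeeze_zero_norm (fun w => h w) (abs_zero (α := ℝ) ▸ (hf i).abs)
  closed := by
    -- Norm approximation is uniform on `Ω`, and uniform limits preserve convergence to `0` along a
    -- filter.
    refine isClosed_of_closure_subset fun f hf i => ?_
    rw [Metric.tendsto_nhds]
    intro ε hε
    obtain ⟨g, hg, hfg⟩ := Metric.mem_closure_iff.1 hf (ε / 2) (half_pos hε)
    filter_upwards [Metric.tendsto_nhds.1 (hg i) (ε / 2) (half_pos hε)] with w hw
    rw [dist_eq_norm] at hfg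
    have h1 := abs_apply_le_norm (f - g) w
    rw [Real.dist_0_eq_abs] at hw ⊢
    have h2 := abs_add_le (f w - g w) (g w)
    rw [sub_add_cancel] at h2
    rw [sub_apply] at h1
    linarith

theorem mem_tendstoZeroIdeal {ι : Type*} {φ : ι → Filter Ω} {f : ChainSpace R} :
    f ∈ (tendstoZeroIdeal R φ).toSubmodule ↔ ∀ i, Filter.Tendsto f (φ i) (nhds 0) := Iff.rfl

end

end ChainSpace

/-! ### Soft thresholding -/

/-- The soft threshold of `t` at level `s`: `t` is moved towards `0` by `s`. -/
noncomputable def softThreshold (s t : ℝ) : ℝ := t - max (-s) (min s t)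

/-- The loss of `s` in modulus is what later makes sums along chains telescope. -/
theorem abs_softThreshold_le {s : ℝ} (hs : 0 ≤ s) (t : ℝ) :
    |softThreshold s t| ≤ max (|t| - s) 0 := by
  unfold softThreshold
  rcases le_total s t with h | h
  · rw [min_eq_left h, max_eq_right (by linarith), abs_of_nonneg (by linarith)]
    exact (sub_le_sub_right (le_abs_self t) s).trans (le_max_left _ _)
  · rw [min_eq_right h]
    rcases le_total (-s) t with h' | h'
    · simp [max_eq_right h']
    · rw [max_eq_left h', abs_of_nonpos (by linarith)]
      exact le_trans (by linarith [neg_le_abs t]) (le_max_left _ _)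

/-- Thresholding at levels tending to `0` therefore does not change limits. -/
theorem abs_softThreshold_sub_le {s : ℝ} (hs : 0 ≤ s) (t : ℝ) :
    |softThreshold s t - t| ≤ s := by
  unfold softThreshold
  rw [sub_sub_cancel_left, abs_neg, abs_le]
  exact ⟨le_max_left _ _, max_le (by linarith) (min_le_left _ _)⟩

/-! ### Homomorphisms separating the points of a distributive lattice -/

section Separation

variable {L : Type u} [DistribLattice L]

/-- The lattice homomorphism that is `a` on a prime ideal and `b` off it, where `a ≤ b`. -/
noncomputable def LatticeHom.ofPrimeIdeal {β : Type*} [Lattice β] (I : Order.Ideal L)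
    (hI : I.IsPrime) {a b : β} (hab : a ≤ b) : LatticeHom L β := by
  classical
  exact
  { toFun := fun x => if x ∈ I then a else b
    map_sup' := by
      intro x y
      by_cases hx : x ∈ I <;> by_cases hy : y ∈ I <;>
        simp [hx, hy, hab, Order.Ideal.sup_mem_iff]
    map_inf' := by
      intro x y
      have h : x ⊓ y ∈ I ↔ x ∈ I ∨ y ∈ I :=
        ⟨hI.mem_or_mem, fun h => h.elim (I.lower inf_le_left) (I.lower inf_le_right)⟩
      by_cases hx : x ∈ I <;> by_cases hy : y ∈ I <;>
        simp [hx, hy, hab, h] }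

theorem LatticeHom.ofPrimeIdeal_of_mem {β : Type*} [Lattice β] {I : Order.Ideal L}
    (hI : I.IsPrime) {a b : β} (hab : a ≤ b) {x : L} (hx : x ∈ I) :
    LatticeHom.ofPrimeIdeal I hI hab x = a := if_pos hx

theorem LatticeHom.ofPrimeIdeal_of_notMem {β : Type*} [Lattice β] {I : Order.Ideal L}
    (hI : I.IsPrime) {a b : β} (hab : a ≤ b) {x : L} (hx : x ∉ I) :
    LatticeHom.ofPrimeIdeal I hI hab x = b := if_neg hx

/-- The principal filter of `d` and the principal ideal of `c` are disjoint, so the prime ideal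
theorem separates them; distributivity enters here. -/
theorem exists_isPrime_ideal_of_not_le {c d : L} (h : ¬ d ≤ c) :
    ∃ I : Order.Ideal L, I.IsPrime ∧ c ∈ I ∧ d ∉ I := by
  have hdis : Disjoint (Order.PFilter.principal d : Set L) (Order.Ideal.principal c : Set L) :=
    Set.disjoint_left.2 fun x hx hx' => h (le_trans hx hx')
  obtain ⟨I, hI, hcI, hd⟩ := DistribLattice.prime_ideal_of_disjoint_filter_ideal hdis
  exact ⟨I, hI, hcI Order.Ideal.mem_principal_self,
    Set.disjoint_left.1 hd (Order.PFilter.mem_principal.2 le_rfl)⟩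

/-- If `L` has no maximum, some element of `𝕃*` vanishes on a given finite set and attains `1`. -/
theorem exists_latticeDual_eq_one [Nonempty L] (h : ¬ ∃ M : L, ∀ x, x ≤ M) (F : Finset L) :
    ∃ (x : LatticeDual L) (d : L), (∀ a ∈ F, (x a : ℝ) = 0) ∧ (x d : ℝ) = 1 := by
  push Not at h
  -- With `c` an upper bound of `F` and `d` not below `c`, a prime ideal containing `c` but not `d`
  -- contains all of `F`.
  obtain ⟨c, hc⟩ := F.exists_le
  obtain ⟨d, hd⟩ := h c
  obtain ⟨I, hI, hcI, hdI⟩ := exists_isPrime_ideal_of_not_le hd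
  have hab : (⟨0, by norm_num⟩ : Set.Icc (-1 : ℝ) 1) ≤ ⟨1, by norm_num⟩ := zero_le_one (α := ℝ)
  refine ⟨LatticeHom.ofPrimeIdeal I hI hab, d, fun a ha => ?_, ?_⟩
  · rw [LatticeHom.ofPrimeIdeal_of_mem hI hab (I.lower (hc a ha) hcI)]
  · rw [LatticeHom.ofPrimeIdeal_of_notMem hI hab hdI]

/-- If `L` has no minimum, some element of `𝕃*` vanishes on a given finite set and attains `-1`. -/
theorem exists_latticeDual_eq_neg_one [Nonempty L] (h : ¬ ∃ m : L, ∀ x, m ≤ x) (F : Finset L) :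
    ∃ (x : LatticeDual L) (d : L), (∀ a ∈ F, (x a : ℝ) = 0) ∧ (x d : ℝ) = -1 := by
  push Not at h
  obtain ⟨c, hc⟩ : ∃ c, ∀ a ∈ F, c ≤ a := Finset.exists_le (α := Lᵒᵈ) F
  obtain ⟨d, hd⟩ := h c
  -- The roles are exchanged: the ideal contains `d` and misses the lower bound `c`, hence misses
  -- all of `F`.
  obtain ⟨I, hI, hdI, hcI⟩ := exists_isPrime_ideal_of_not_le hd
  have hab : (⟨-1, by norm_num⟩ : Set.Icc (-1 : ℝ) 1) ≤ ⟨0, by norm_num⟩ :=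
    neg_nonpos.2 (zero_le_one (α := ℝ))
  refine ⟨LatticeHom.ofPrimeIdeal I hI hab, d, fun a ha => ?_, ?_⟩
  · rw [LatticeHom.ofPrimeIdeal_of_notMem hI hab fun haI => hcI (I.lower (hc a ha) haI)]
  · rw [LatticeHom.ofPrimeIdeal_of_mem hI hab hdI]

end Separation

/-! ### Decay of elements of `FBL L` on homomorphisms vanishing on large finite sets -/

namespace FreeBanachLattice

section

variable {L : Type u} [Lattice L]

/-- `y` vanishes on the finite set `F`. -/
def VanishesOn (y : LatticeDual L) (F : Finset L) : Prop := ∀ a ∈ F, (y a : ℝ) = 0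

theorem VanishesOn.mono {y : LatticeDual L} {F G : Finset L} (h : VanishesOn y G) (hFG : F ⊆ G) :
    VanishesOn y F := fun a ha => h a (hFG ha)

variable (L) in
/-- The functions on `𝕃*` that are uniformly small on the homomorphisms vanishing on a large finite
set form a closed vector sublattice. -/
def tailSmall : ClosedVectorSublattice (FunSpace L) where
  carrier := {p | ∀ ε > 0, ∃ F : Finset L, ∀ y, VanishesOn y F → |p y| ≤ ε}
  zero_mem' ε hε := ⟨∅, fun y _ => by
    rw [show (0 : FunSpace L) y = 0 from rfl, abs_zero]; exact hε.le⟩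
  add_mem' {p q} hp hq ε hε := by
    classical
    obtain ⟨F, hF⟩ := hp _ (half_pos hε)
    obtain ⟨G, hG⟩ := hq _ (half_pos hε)
    refine ⟨F ∪ G, fun y hy => (abs_add_le (p y) (q y)).trans ?_⟩
    linarith [hF y (hy.mono Finset.subset_union_left), hG y (hy.mono Finset.subset_union_right)]
  smul_mem' c p hp ε hε := by
    -- The summand `1` keeps the denominator positive when `c = 0`.
    obtain ⟨F, hF⟩ := hp (ε / (|c| + 1)) (by positivity)
    refine ⟨F, fun y hy => ?_⟩
    rw [FunSpace.coe_smul, Pi.smul_apply, smul_eq_mul, abs_mul]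
    have h1 := hF y hy
    rw [le_div_iff₀ (by positivity)] at h1
    nlinarith [abs_nonneg (p y)]
  sup_mem p q hp hq ε hε := by
    classical
    obtain ⟨F, hF⟩ := hp ε hε
    obtain ⟨G, hG⟩ := hq ε hε
    exact ⟨F ∪ G, fun y hy => abs_max_le_max_abs_abs.trans
      (max_le (hF y (hy.mono Finset.subset_union_left))
        (hG y (hy.mono Finset.subset_union_right)))⟩
  inf_mem p q hp hq ε hε := by
    classical
    obtain ⟨F, hF⟩ := hp ε hε
    obtain ⟨G, hG⟩ := hq ε hε
    exact ⟨F ∪ G, fun y hy => abs_min_le_max_abs_abs.trans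
      (max_le (hF y (hy.mono Finset.subset_union_left))
        (hG y (hy.mono Finset.subset_union_right)))⟩
  closed := by
    refine isClosed_of_closure_subset fun p hp ε hε => ?_
    obtain ⟨q, hq, hpq⟩ := Metric.mem_closure_iff.1 hp (ε / 2) (half_pos hε)
    obtain ⟨F, hF⟩ := hq _ (half_pos hε)
    refine ⟨F, fun y hy => ?_⟩
    rw [dist_eq_norm] at hpq
    have h1 : |p y - q y| ≤ ‖p - q‖ := FunSpace.abs_apply_le_norm (p - q) y
    have h2 := abs_add_le (p y - q y) (q y)
    rw [sub_add_cancel] at h2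
    linarith [hF y hy]

theorem delta_mem_tailSmall (a : L) : delta a ∈ (tailSmall L).toSubmodule := by
  refine fun ε hε => ⟨{a}, fun y hy => ?_⟩
  have h : delta a y = 0 := hy a (Finset.mem_singleton_self a)
  rw [h, abs_zero]
  exact hε.le

/-- `FBL L` is the smallest closed vector sublattice containing the evaluations, and `tailSmall L`
is one such sublattice. -/
theorem mem_tailSmall_of_FBL (p : FBL L) : (p : FunSpace L) ∈ (tailSmall L).toSubmodule :=
  (Submodule.mem_sInf.1 p.2) _ ⟨tailSmall L, rfl, by
    rintro _ ⟨a, rfl⟩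
    exact delta_mem_tailSmall a⟩

/-- The supremum of `|p|` over the homomorphisms vanishing on `F`. -/
noncomputable def tailSup (p : FunSpace L) (F : Finset L) : ℝ :=
  ⨆ y : {y : LatticeDual L // VanishesOn y F}, |p y|

theorem tailSup_nonneg (p : FunSpace L) (F : Finset L) : 0 ≤ tailSup p F :=
  Real.iSup_nonneg fun _ => abs_nonneg _

/-- The condition `0 ≤ c` covers the default value `0` of an empty real supremum, so no homomorphism
vanishing on `F` has to be exhibited. -/
theorem tailSup_le (p : FunSpace L) {F : Finset L} {c : ℝ} (hc : 0 ≤ c)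
    (h : ∀ y, VanishesOn y F → |p y| ≤ c) : tailSup p F ≤ c :=
  Real.iSup_le (fun y => h y y.2) hc

theorem abs_le_tailSup (p : FunSpace L) {F : Finset L} {y : LatticeDual L}
    (hy : VanishesOn y F) : |p y| ≤ tailSup p F :=
  le_ciSup (f := fun y : {y : LatticeDual L // VanishesOn y F} => |p y|)
    ⟨‖p‖, by rintro _ ⟨z, rfl⟩; exact FunSpace.abs_apply_le_norm p z⟩ ⟨y, hy⟩

theorem tailSup_anti (p : FunSpace L) {F G : Finset L} (h : F ⊆ G) :
    tailSup p G ≤ tailSup p F :=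
  tailSup_le p (tailSup_nonneg p F) fun _ hy => abs_le_tailSup p (hy.mono h)

theorem tendsto_tailSup {p : FunSpace L} (hp : p ∈ (tailSmall L).toSubmodule) :
    Filter.Tendsto (tailSup p) Filter.atTop (nhds 0) := by
  rw [Metric.tendsto_nhds]
  intro ε hε
  obtain ⟨F, hF⟩ := hp (ε / 2) (half_pos hε)
  filter_upwards [Filter.eventually_ge_atTop F] with G hG
  rw [Real.dist_0_eq_abs, abs_of_nonneg (tailSup_nonneg p G)]
  linarith [tailSup_anti p hG, tailSup_le p (half_pos hε).le hF]

/-! ### Truncation and the homomorphism into the quotient -/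

variable (L) in
/-- The relation on pairs of a homomorphism and a finite set: the finite sets increase, and later
homomorphisms vanish on earlier sets. -/
def TailRel (v w : LatticeDual L × Finset L) : Prop := v.2 ⊆ w.2 ∧ VanishesOn w.1 v.2

/-- The truncation of `p` to a function of pairs. -/
noncomputable def truncFun (p : FunSpace L) (w : LatticeDual L × Finset L) : ℝ :=
  softThreshold (tailSup p w.2) (p w.1)

/-- Along a chain the sums of the truncation telescope. -/
theorem sum_abs_truncFun_le (p : FunSpace L) (l : List (LatticeDual L × Finset L))
    (hl : l.Pairwise (TailRel L)) (G : Finset L) (hG : ∀ w ∈ l, G ⊆ w.2 ∧ VanishesOn w.1 G) :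
    (l.map fun w => |truncFun p w|).sum ≤ tailSup p G := by
  induction l generalizing G with
  | nil => simpa using tailSup_nonneg p G
  | cons v l ih =>
    rw [List.pairwise_cons] at hl
    -- By `TailRel`, the pairs after `v` satisfy the hypothesis with `v.2` in place of `G`, so they
    -- contribute at most `tailSup p v.2`.
    have h1 := ih hl.2 v.2 hl.1
    obtain ⟨h2, h3⟩ := hG v List.mem_cons_self
    -- Since `v.1` vanishes on `G`, `|p v.1|` is at most `tailSup p G`, and thresholding removes
    -- `tailSup p v.2` from it.
    have h4 : |truncFun p v| ≤ tailSup p G - tailSup p v.2 := by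
      refine (abs_softThreshold_le (tailSup_nonneg p v.2) _).trans (max_le ?_ ?_)
      · exact sub_le_sub_right (abs_le_tailSup p h3) _
      · exact sub_nonneg.2 (tailSup_anti p h2)
    rw [List.map_cons, List.sum_cons]
    linarith

/-- Telescoping starts from `G = ∅`, which constrains nothing. -/
theorem sum_abs_truncFun_le_norm (p : FunSpace L) (l : List (LatticeDual L × Finset L))
    (hl : l.Pairwise (TailRel L)) : (l.map fun w => |truncFun p w|).sum ≤ ‖p‖ :=
  (sum_abs_truncFun_le p l hl ∅ fun _ _ => ⟨Finset.empty_subset _, by simp [VanishesOn]⟩).trans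
    (tailSup_le p (norm_nonneg p) fun y _ => FunSpace.abs_apply_le_norm p y)

/-- The truncation of `p` as an element of the Banach lattice of the relation `TailRel L`. -/
noncomputable def trunc (p : FunSpace L) : ChainSpace (TailRel L) :=
  ChainSpace.ofFun (truncFun p) ⟨‖p‖, sum_abs_truncFun_le_norm p⟩

theorem norm_trunc_le (p : FunSpace L) : ‖trunc p‖ ≤ ‖p‖ :=
  ChainSpace.norm_le (sum_abs_truncFun_le_norm p)

/-- The filter of pairs `(x, F)` with `F` growing. -/
def tailFilter (x : LatticeDual L) : Filter (LatticeDual L × Finset L) :=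
  Filter.map (Prod.mk x) Filter.atTop

/-- At `(x, F)` the truncation differs from `p x` by at most `tailSup p F`, which tends to `0`. -/
theorem tendsto_trunc {p : FunSpace L} (hp : p ∈ (tailSmall L).toSubmodule)
    (x : LatticeDual L) : Filter.Tendsto (trunc p) (tailFilter x) (nhds (p x)) := by
  rw [tailFilter, Filter.tendsto_map'_iff, tendsto_iff_dist_tendsto_zero]
  exact squeeze_zero (fun _ => dist_nonneg)
    (fun F => abs_softThreshold_sub_le (tailSup_nonneg p F) (p x)) (tendsto_tailSup hp)

variable (L) in
/-- The ideal of functions of pairs that tend to `0` along growing finite sets. -/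
noncomputable def tailIdeal : ClosedIdeal (ChainSpace (TailRel L)) :=
  ChainSpace.tendstoZeroIdeal (TailRel L) tailFilter

/-- Truncation itself need not respect sums, multiples or lattice operations. Modulo the ideal only
limits matter, and these do respect them. -/
theorem mk_eq_mk_of_tendsto {f g : ChainSpace (TailRel L)} {p : LatticeDual L → ℝ}
    (hf : ∀ x, Filter.Tendsto f (tailFilter x) (nhds (p x)))
    (hg : ∀ x, Filter.Tendsto g (tailFilter x) (nhds (p x))) :
    (Submodule.Quotient.mk f : ChainSpace (TailRel L) ⧸ (tailIdeal L).toSubmodule) =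
      Submodule.Quotient.mk g := by
  rw [Submodule.Quotient.eq]
  exact fun x => sub_self (p x) ▸ (hf x).sub (hg x)

variable (L) in
/-- Truncation induces a linear map from `FBL⟨L⟩` to the quotient by `tailIdeal L`. -/
noncomputable def truncLinear :
    FBL L →ₗ[ℝ] ChainSpace (TailRel L) ⧸ (tailIdeal L).toSubmodule where
  toFun p := Submodule.Quotient.mk (trunc (p : FunSpace L))
  map_add' p q := by
    rw [← Submodule.Quotient.mk_add]
    exact mk_eq_mk_of_tendsto (tendsto_trunc (mem_tailSmall_of_FBL (p + q)))
      fun x => (tendsto_trunc (mem_tailSmall_of_FBL p) x).add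
        (tendsto_trunc (mem_tailSmall_of_FBL q) x)
  map_smul' c p := by
    rw [RingHom.id_apply, ← Submodule.Quotient.mk_smul]
    exact mk_eq_mk_of_tendsto (tendsto_trunc (mem_tailSmall_of_FBL (c • p)))
      fun x => (tendsto_trunc (mem_tailSmall_of_FBL p) x).const_mul c

variable (L) in
/-- The map `truncLinear L` as a bounded operator. -/
noncomputable def truncCLM :
    FBL L →L[ℝ] ChainSpace (TailRel L) ⧸ (tailIdeal L).toSubmodule :=
  (truncLinear L).mkContinuous 1 fun p => by
    rw [one_mul]
    exact (Submodule.Quotient.norm_mk_le _ _).trans (norm_trunc_le (p : FunSpace L))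

theorem truncCLM_apply (p : FBL L) :
    truncCLM L p = Submodule.Quotient.mk (trunc (p : FunSpace L)) := rfl

theorem preservesLattice_truncCLM : PreservesLattice (truncCLM L) := by
  constructor
  · intro p q
    simp only [truncCLM_apply, ← ClosedIdeal.mk_sup]
    exact mk_eq_mk_of_tendsto (tendsto_trunc (mem_tailSmall_of_FBL (p ⊔ q)))
      fun x => (tendsto_trunc (mem_tailSmall_of_FBL p) x).max
        (tendsto_trunc (mem_tailSmall_of_FBL q) x)
  · intro p q
    simp only [truncCLM_apply, ← ClosedIdeal.mk_inf]
    exact mk_eq_mk_of_tendsto (tendsto_trunc (mem_tailSmall_of_FBL (p ⊓ q)))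
      fun x => (tendsto_trunc (mem_tailSmall_of_FBL p) x).min
        (tendsto_trunc (mem_tailSmall_of_FBL q) x)

/-! ### Increasing lifts of the evaluations and long chains -/

variable (L) in
/-- Evaluation at `a` as an element of `FBL⟨L⟩`. -/
noncomputable def deltaFBL (a : L) : FBL L :=
  ⟨delta a, Submodule.mem_sInf.2 fun _ hV => by
    obtain ⟨S, rfl, hS⟩ := hV
    exact hS ⟨a, rfl⟩⟩

theorem deltaFBL_mono : Monotone (deltaFBL L) := fun a b hab x => by
  have h : x a ≤ x b := OrderHomClass.mono x hab
  exact h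

theorem norm_deltaFBL_le (a : L) : ‖deltaFBL L a‖ ≤ 1 :=
  FunSpace.norm_le (f := delta a) zero_le_one fun _ _ hx => hx a

/-- A projective `FBL⟨L⟩` yields a bounded increasing family of functions of pairs that extends
the evaluations. -/
theorem exists_monotone_lift {lam : ℝ} (h : IsProjective lam (FBL L)) :
    ∃ (g : L → ChainSpace (TailRel L)) (C : ℝ), Monotone g ∧ (∀ a, ‖g a‖ ≤ C) ∧
      ∀ a (x : LatticeDual L), Filter.Tendsto (g a) (tailFilter x) (nhds (x a : ℝ)) := by
  obtain ⟨S, hS, hlift, -⟩ := h _ (tailIdeal L) (truncCLM L) preservesLattice_truncCLM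
  refine ⟨fun a => S (deltaFBL L a), ‖S‖, fun a b hab => ?_, fun a => ?_, fun a x => ?_⟩
  · have := hS.1 (deltaFBL L a) (deltaFBL L b)
    rw [sup_eq_right.2 (deltaFBL_mono hab)] at this
    exact sup_eq_right.1 this.symm
  · exact (S.le_opNorm _).trans (mul_le_of_le_one_right (norm_nonneg S) (norm_deltaFBL_le a))
  -- The lift differs from `trunc (delta a)` by an element of the ideal, so both have the same limit
  -- `x a`.
  · have h1 := hlift (deltaFBL L a)
    rw [truncCLM_apply, Submodule.Quotient.eq] at h1
    have h2 := (h1 x).add (tendsto_trunc (mem_tailSmall_of_FBL (deltaFBL L a)) x)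
    rw [zero_add] at h2
    refine h2.congr fun w => ?_
    exact sub_add_cancel _ _

/-- If every finite set admits a pair vanishing on it at which some `g d` is large, then a directed
monotone family `g` is large along arbitrarily long chains. -/
theorem exists_long_chain {D : Type*} [SemilatticeSup D] [Nonempty D]
    {g : D → LatticeDual L × Finset L → ℝ}
    (hg : Monotone g)
    (hstep : ∀ G : Finset L, ∃ d x F, G ⊆ F ∧ VanishesOn x G ∧ 1 / 2 ≤ g d (x, F))
    (N : ℕ) (G : Finset L) :
    ∃ (b : D) (l : List (LatticeDual L × Finset L)), l.length = N ∧ l.Pairwise (TailRel L) ∧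
      (∀ w ∈ l, G ⊆ w.2 ∧ VanishesOn w.1 G) ∧ ∀ w ∈ l, 1 / 2 ≤ g b w := by
  induction N generalizing G with
  | zero => exact ⟨Classical.arbitrary D, [], rfl, List.Pairwise.nil, by simp, by simp⟩
  | succ N ih =>
    obtain ⟨d, x, F, hGF, hx, hd⟩ := hstep G
    -- Continuing from `F` rather than `G` makes every later pair `TailRel`-related to `(x, F)`.
    obtain ⟨b, l, hlen, hl, hF, hb⟩ := ih F
    refine ⟨d ⊔ b, (x, F) :: l, by simp [hlen], List.pairwise_cons.2 ⟨hF, hl⟩, ?_, ?_⟩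
    · intro w hw
      rcases List.mem_cons.1 hw with rfl | hw
      · exact ⟨hGF, hx⟩
      · exact ⟨hGF.trans (hF w hw).1, (hF w hw).2.mono hGF⟩
    · intro w hw
      rcases List.mem_cons.1 hw with rfl | hw
      · exact hd.trans (hg le_sup_left _)
      · exact (hb w hw).trans (hg le_sup_right _)

/-- A norm-bounded directed monotone family cannot be large on such pairs. -/
theorem false_of_bounded_of_step {D : Type*} [SemilatticeSup D] [Nonempty D]
    {g : D → ChainSpace (TailRel L)} {C : ℝ} (hg : Monotone g) (hC : ∀ a, ‖g a‖ ≤ C)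
    (hstep : ∀ G : Finset L, ∃ d x, VanishesOn x G ∧
      Filter.Tendsto (g d) (tailFilter x) (nhds 1)) : False := by
  -- A chain of length `N` with values at least `1/2` forces norm at least `N/2 > C`.
  obtain ⟨N, hN⟩ := exists_nat_gt (2 * C)
  obtain ⟨b, l, hlen, hl, -, hb⟩ := exists_long_chain (g := fun d w => g d w)
    (fun _ _ h w => hg h w) (fun G => by
      obtain ⟨d, x, hx, ht⟩ := hstep G
      rw [tailFilter, Filter.tendsto_map'_iff] at ht
      -- The limit `1` gives values at least `1/2` for all large `F`, in particular for some `F`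
      -- containing `G`.
      obtain ⟨F, hF, hGF⟩ := ((ht.eventually (eventually_ge_nhds one_half_lt_one)).and
        (Filter.eventually_ge_atTop G)).exists
      exact ⟨d, x, F, hGF, hx, hF⟩) N ∅
  have h1 := (ChainSpace.sum_le_norm (g b) hl).trans (hC b)
  have h2 := List.card_nsmul_le_sum (l.map fun w => |g b w|) (1 / 2) (by
    intro t ht
    obtain ⟨w, hw, rfl⟩ := List.mem_map.1 ht
    exact (hb w hw).trans (le_abs_self _))
  rw [List.length_map, hlen, nsmul_eq_mul] at h2
  linarith

end

end FreeBanachLattice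

theorem theorem3p6 {L : Type u} [DistribLattice L] [Nonempty L]
    (h : IsInftyProjective (FBL L)) :
    (∃ M : L, ∀ x : L, x ≤ M) ∧ (∃ m : L, ∀ x : L, m ≤ x) := by
  obtain ⟨lam, -, hlam⟩ := h
  obtain ⟨g, C, hg, hC, ht⟩ := FreeBanachLattice.exists_monotone_lift hlam
  constructor
  · by_contra hmax
    refine FreeBanachLattice.false_of_bounded_of_step hg hC fun G => ?_
    obtain ⟨x, d, hx, hd⟩ := exists_latticeDual_eq_one hmax G
    exact ⟨d, x, hx, hd ▸ ht d x⟩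
  · by_contra hmin
    -- On the order dual, `-g` is again increasing with the same norm bound, and the value `-1` of
    -- `x` at `d` becomes the limit `1`.
    refine FreeBanachLattice.false_of_bounded_of_step (D := Lᵒᵈ)
      (g := fun a => -g (OrderDual.ofDual a)) (C := C)
      (fun a b hab => neg_le_neg (hg hab)) (fun a => (norm_neg _).trans_le (hC _)) fun G => ?_
    obtain ⟨x, d, hx, hd⟩ := exists_latticeDual_eq_neg_one hmin G
    refine ⟨OrderDual.toDual d, x, hx, ?_⟩
    have := (ht d x).neg
    rw [hd, neg_neg] at this
    exact this
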